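/- Let $p$ be a prime with $p\neq 2$, and let $\zeta\in\mathbb{Z}_p$ be such that $x^2+\zeta$ is irreducible modulo $p$ (that is, in $\mathbb{F}_p[x]$). Identify the monic quartics $x^4+c_3x^3+c_2x^2+c_1x+c_0\in\mathbb{Z}_p[x]$ with $\mathbb{Z}_p^4$ and the monic quartics $x^4+c_2x^2+c_1x+c_0$ with zero $x^3$ term with $\mathbb{Z}_p^3$, through their coefficients, each with its normalised Haar measure $\mu$. In each of these two spaces, let $D$ be the set of polynomials $f$ with $f\equiv(x^2+\zeta)^2\pmod p$ and let $S$ be the set of polynomials that are irreducible in $\mathbb{Z}_p[x]$. Then, in each of the two spaces, $S$ is Borel measurable and the proportion of irreducible polynomials in $D$ is $$\frac{\mu(D\cap S)}{\mu(D)}=\frac{2p^2+1}{2(p^2+1)}.$$ -/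

import Mathlib

open MeasureTheory Polynomial

namespace PadicQuartic

variable (p : ℕ) [Fact p.Prime]

/-- `ℤ_[p]` carries its Borel sigma-algebra. -/
noncomputable instance instMeasurableSpacePadicInt : MeasurableSpace ℤ_[p] := borel ℤ_[p]

instance instBorelSpacePadicInt : BorelSpace ℤ_[p] := ⟨rfl⟩

/-- The Haar measure on `ℤ_[p]ⁿ`, normalised so that the whole (compact) group has measure `1`. -/
noncomputable def haar (n : ℕ) : Measure (Fin n → ℤ_[p]) := Measure.addHaarMeasure ⊤

variable {p}

/-- The proportion of the points of `D` that lie in `S`, with respect to Haar measure. -/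
noncomputable def proportion {n : ℕ} (D S : Set (Fin n → ℤ_[p])) : ℝ :=
  (haar p n).real (D ∩ S) / (haar p n).real D

/-- The monic quartic `x⁴ + c₃ x³ + c₂ x² + c₁ x + c₀` over `ℤ_[p]`. -/
noncomputable def monicQuartic (c : Fin 4 → ℤ_[p]) : ℤ_[p][X] :=
  X ^ 4 + C (c 3) * X ^ 3 + C (c 2) * X ^ 2 + C (c 1) * X + C (c 0)

/-- The monic quartic `x⁴ + c₂ x² + c₁ x + c₀` over `ℤ_[p]`, with zero `x³` term. -/
noncomputable def tracelessQuartic (c : Fin 3 → ℤ_[p]) : ℤ_[p][X] :=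
  X ^ 4 + C (c 2) * X ^ 2 + C (c 1) * X + C (c 0)

/-- Congruence modulo `p` of polynomials over `ℤ_[p]`: equal reductions in `𝔽_p[x]`. -/
def CongrModP (f g : ℤ_[p][X]) : Prop :=
  f.map PadicInt.toZMod = g.map PadicInt.toZMod

end PadicQuartic

/-! Complete the square: `f = g² - r` with `g = x² + α x + β` fixed by the top coefficients of `f`
and `r` of degree at most 1. Modulo `p`, `f` is the square of an irreducible quadratic, so a proper
factorisation over `ℤ_[p]` has two quadratic factors congruent to each other. Writing them as `g +
e₁²/2 ± (e₁ x + e₀)`, with `e ≡ 0`, turns `f = g² - r` into `r = sqForm α β (1/4) e`.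

Up to a quartic correction, `sqForm` is squaring in `ℤ_[p][x]/(g)`. Extracting `p ^ k` from `e`, `k
≥ 1`, makes the correction vanish modulo `p`, and Hensel's lemma (`exists_sqForm_eq`) shows that the
attained `r` form `p² E`, where `E` (`evenSquares`) consists of 0 and the even powers of `p` times
lifts of nonzero squares of `𝔽_{p²}`.

Half of the nonzero residues are squares and `E = U ∪ p² E` disjointly, with `U` the unit part, so
`m = μ(E)` satisfies `m = (p² - 1)/(2p²) + m/p⁴`. For fixed top coefficients `r` is a reflection of
the bottom ones, hence Haar distributed; conditioned on `r ≡ 0`, reducibility has probability `m/p²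
= 1/(2(p² + 1))`. -/

namespace PadicQuartic
-- Perturbed squares in the unramified quadratic extension
section Squares

/-- The coordinates, in the basis `x, 1`, of `(e₁ x + e₀)² - ε e₁⁴` modulo `x² + α x + β`,
where `e = (e₁, e₀)`. -/
def sqForm {R : Type*} [CommRing R] (α β ε : R) (e : R × R) : R × R :=
  (2 * e.1 * e.2 - α * e.1 ^ 2, e.2 ^ 2 - β * e.1 ^ 2 - ε * e.1 ^ 4)

lemma map_sqForm {R S : Type*} [CommRing R] [CommRing S] (φ : R →+* S) (α β ε : R) (e : R × R) :
    φ.prodMap φ (sqForm α β ε e) = sqForm (φ α) (φ β) (φ ε) (φ.prodMap φ e) := by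
  simp [sqForm, map_ofNat]

/-- Only the quartic term fails to be homogeneous of degree 2; scaling by `p` therefore makes it
negligible modulo `p`. -/
lemma sqForm_smul {R : Type*} [CommRing R] (α β ε c : R) (e : R × R) :
    sqForm α β ε (c • e) = c ^ 2 • sqForm α β (c ^ 2 * ε) e := by
  ext <;> simp [sqForm] <;> ring

lemma sqForm_neg {R : Type*} [CommRing R] (α β ε : R) (e : R × R) :
    sqForm α β ε (-e) = sqForm α β ε e := by
  ext <;> simp [sqForm]
  ring

section Field
variable {K : Type*} [Field K] {z : K}

/-- `b² + z a²` is the norm of `a x + b` from the field `K[x]/(x² + z)`. -/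
lemma norm_anisotropic (hz : ∀ t : K, t ^ 2 + z ≠ 0) {a b : K} (h : b ^ 2 + z * a ^ 2 = 0) :
    a = 0 ∧ b = 0 := by
  have ha : a = 0 := by
    by_contra ha
    apply hz (b / a)
    field_simp
    linear_combination h
  subst ha
  simpa using h

lemma norm_sqForm (e : K × K) :
    (sqForm 0 z 0 e).2 ^ 2 + z * (sqForm 0 z 0 e).1 ^ 2 = (e.2 ^ 2 + z * e.1 ^ 2) ^ 2 := by
  simp only [sqForm]; ring

lemma sqForm_eq_zero (hz : ∀ t : K, t ^ 2 + z ≠ 0) {e : K × K} (h : sqForm 0 z 0 e = 0) :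
    e = 0 := by
  have h1 := norm_sqForm (z := z) e
  rw [h] at h1
  have h2 := norm_anisotropic hz (a := e.1) (b := e.2) (by
    apply pow_eq_zero_iff (two_ne_zero) |>.1
    rw [← h1]; simp)
  exact Prod.ext h2.1 h2.2

/-- Take norms in `(e - e')(e + e') = e² - e'²`, where the norm is multiplicative and anisotropic.
-/
lemma eq_or_eq_neg_of_sqForm_eq (hz : ∀ t : K, t ^ 2 + z ≠ 0) {e e' : K × K}
    (h : sqForm 0 z 0 e = sqForm 0 z 0 e') : e = e' ∨ e = -e' := by
  simp only [sqForm, Prod.mk.injEq] at h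
  obtain ⟨h1, h2⟩ := h
  have key : ((e.2 - e'.2) ^ 2 + z * (e.1 - e'.1) ^ 2) *
      ((e.2 + e'.2) ^ 2 + z * (e.1 + e'.1) ^ 2) = 0 := by
    have h1' : 2 * e.1 * e.2 - 2 * e'.1 * e'.2 = 0 := by linear_combination h1
    have h2' : e.2 ^ 2 - z * e.1 ^ 2 - (e'.2 ^ 2 - z * e'.1 ^ 2) = 0 := by linear_combination h2
    have : ((e.2 - e'.2) ^ 2 + z * (e.1 - e'.1) ^ 2) *
      ((e.2 + e'.2) ^ 2 + z * (e.1 + e'.1) ^ 2) =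
      (e.2 ^ 2 - z * e.1 ^ 2 - (e'.2 ^ 2 - z * e'.1 ^ 2)) ^ 2
        + z * (2 * e.1 * e.2 - 2 * e'.1 * e'.2) ^ 2 := by ring
    rw [this, h1', h2']; ring
  rcases mul_eq_zero.1 key with h | h
  · left
    have := norm_anisotropic hz h
    exact Prod.ext (sub_eq_zero.1 this.1) (sub_eq_zero.1 this.2)
  · right
    have := norm_anisotropic hz h
    exact Prod.ext (eq_neg_of_add_eq_zero_left this.1) (eq_neg_of_add_eq_zero_left this.2)

end Field

variable {p : ℕ} [Fact p.Prime]

lemma toZMod_eq_zero_iff (x : ℤ_[p]) : PadicInt.toZMod x = 0 ↔ (p : ℤ_[p]) ∣ x := by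
  rw [← RingHom.mem_ker, PadicInt.ker_toZMod, PadicInt.maximalIdeal_eq_span_p,
    Ideal.mem_span_singleton]

/-- Coordinatewise reduction modulo `p`. -/
noncomputable def red (p : ℕ) [Fact p.Prime] : ℤ_[p] × ℤ_[p] →+* ZMod p × ZMod p :=
  PadicInt.toZMod.prodMap PadicInt.toZMod

lemma red_apply (x : ℤ_[p] × ℤ_[p]) :
    red p x = (PadicInt.toZMod x.1, PadicInt.toZMod x.2) := rfl

lemma red_surjective : Function.Surjective (red p) := fun x ↦ by
  obtain ⟨a, ha⟩ := ZMod.ringHom_surjective (PadicInt.toZMod (p := p)) x.1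
  obtain ⟨b, hb⟩ := ZMod.ringHom_surjective (PadicInt.toZMod (p := p)) x.2
  exact ⟨(a, b), by simp [red_apply, ha, hb]⟩

lemma red_eq_zero_iff (x : ℤ_[p] × ℤ_[p]) : red p x = 0 ↔ ∃ y, x = (p : ℤ_[p]) • y := by
  rw [red_apply, Prod.mk_eq_zero, toZMod_eq_zero_iff, toZMod_eq_zero_iff]
  constructor
  · rintro ⟨⟨a, ha⟩, ⟨b, hb⟩⟩
    exact ⟨(a, b), Prod.ext ha hb⟩
  · rintro ⟨y, rfl⟩
    exact ⟨⟨y.1, rfl⟩, ⟨y.2, rfl⟩⟩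

lemma red_sqForm (α β ε : ℤ_[p]) (e : ℤ_[p] × ℤ_[p]) :
    red p (sqForm α β ε e) = sqForm (PadicInt.toZMod α) (PadicInt.toZMod β) (PadicInt.toZMod ε)
      (red p e) :=
  map_sqForm _ _ _ _ _

/-- A nonzero vector is a power of `p` times a vector which is nonzero modulo `p`. -/
lemma exists_eq_pow_smul {d : ℤ_[p] × ℤ_[p]} (hd : d ≠ 0) :
    ∃ (k : ℕ) (e : ℤ_[p] × ℤ_[p]), red p e ≠ 0 ∧ d = (p : ℤ_[p]) ^ k • e := by
  by_contra! H
  have key : ∀ k : ℕ, ∃ e, d = (p : ℤ_[p]) ^ k • e := by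
    intro k
    induction k with
    | zero => exact ⟨d, by simp⟩
    | succ k ih =>
      obtain ⟨e, he⟩ := ih
      by_cases h : red p e = 0
      · obtain ⟨y, rfl⟩ := (red_eq_zero_iff e).1 h
        exact ⟨y, by rw [he, smul_smul, pow_succ]⟩
      · exact absurd he (H k e h)
  have aux : ∀ x : ℤ_[p], (∀ k : ℕ, (p : ℤ_[p]) ^ k ∣ x) → x = 0 := by
    intro x hx
    by_contra h0
    have h1 := hx (x.valuation + 1)
    rw [← Ideal.mem_span_singleton, PadicInt.mem_span_pow_iff_le_valuation x h0] at h1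
    omega
  apply hd
  refine Prod.ext (aux _ fun k ↦ ?_) (aux _ fun k ↦ ?_)
  · obtain ⟨e, rfl⟩ := key k
    exact ⟨e.1, rfl⟩
  · obtain ⟨e, rfl⟩ := key k
    exact ⟨e.2, rfl⟩

lemma continuous_sqForm (α β ε : ℤ_[p]) : Continuous (sqForm α β ε) := by
  unfold sqForm; fun_prop

/-- Hensel's lemma for `sqForm`. -/
lemma exists_sqForm_eq (hp : p ≠ 2) {z : ZMod p} (hz : ∀ t, t ^ 2 + z ≠ 0) {α β ε : ℤ_[p]}
    (hα : PadicInt.toZMod α = 0) (hβ : PadicInt.toZMod β = z) (hε : PadicInt.toZMod ε = 0)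
    {s : ℤ_[p] × ℤ_[p]} {e₀ : ZMod p × ZMod p} (he₀ : e₀ ≠ 0) (hs : red p s = sqForm 0 z 0 e₀) :
    ∃ e, sqForm α β ε e = s := by
  have h2 : (2 : ZMod p) ≠ 0 := Ring.two_ne_zero (by rwa [ZMod.ringChar_zmod_n])
  -- Newton iteration: solutions modulo `p ^ (n + 1)`, all with reduction `e₀`.
  have approx : ∀ n : ℕ, ∃ e t, red p e = e₀ ∧ s = sqForm α β ε e + (p : ℤ_[p]) ^ (n + 1) • t := by
    intro n
    induction n with
    | zero =>
      obtain ⟨e, he⟩ := red_surjective e₀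
      obtain ⟨t, ht⟩ := (red_eq_zero_iff (s - sqForm α β ε e)).1 (by
        rw [map_sub, red_sqForm, hs, hα, hβ, hε, he, sub_self])
      exact ⟨e, t, he, by rw [zero_add, pow_one, ← ht]; abel⟩
    | succ n ih =>
      obtain ⟨e, t, he, hst⟩ := ih
      have hN : e₀.2 ^ 2 + z * e₀.1 ^ 2 ≠ 0 := fun h ↦
        he₀ (Prod.ext (norm_anisotropic hz h).1 (norm_anisotropic hz h).2)
      set N := e₀.2 ^ 2 + z * e₀.1 ^ 2 with hNdef
      -- solve `2 e₀ δ = t` in the residue field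
      obtain ⟨δ, hδ⟩ := red_surjective (p := p)
        ((e₀.2 * (red p t).1 - e₀.1 * (red p t).2) / (2 * N),
          (e₀.2 * (red p t).2 + z * e₀.1 * (red p t).1) / (2 * N))
      have hδ1 : PadicInt.toZMod δ.1 = (e₀.2 * (red p t).1 - e₀.1 * (red p t).2) / (2 * N) :=
        congrArg Prod.fst hδ
      have hδ2 : PadicInt.toZMod δ.2 = (e₀.2 * (red p t).2 + z * e₀.1 * (red p t).1) / (2 * N) :=
        congrArg Prod.snd hδ
      have he1 : PadicInt.toZMod e.1 = e₀.1 := congrArg Prod.fst he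
      have he2 : PadicInt.toZMod e.2 = e₀.2 := congrArg Prod.snd he
      set P : ℤ_[p] := (p : ℤ_[p]) ^ (n + 1) with hP
      have hP0 : PadicInt.toZMod P = 0 := by simp [hP]
      -- The error left after replacing `e` by `e + P δ`, divided by `P`; the choice of `δ` makes it
      -- vanish modulo `p`.
      let v : ℤ_[p] × ℤ_[p] :=
        (t.1 - (2 * (e.1 * δ.2 + e.2 * δ.1) - 2 * α * e.1 * δ.1
            + P * (2 * δ.1 * δ.2 - α * δ.1 ^ 2)),
          t.2 - (2 * e.2 * δ.2 - 2 * β * e.1 * δ.1 + P * (δ.2 ^ 2 - β * δ.1 ^ 2)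
            - ε * (4 * e.1 ^ 3 * δ.1 + 6 * P * e.1 ^ 2 * δ.1 ^ 2 + 4 * P ^ 2 * e.1 * δ.1 ^ 3
              + P ^ 3 * δ.1 ^ 4)))
      have hv : red p v = 0 := by
        rw [red_apply, Prod.mk_eq_zero]
        have ht1 : PadicInt.toZMod t.1 = (red p t).1 := rfl
        have ht2 : PadicInt.toZMod t.2 = (red p t).2 := rfl
        simp only [v, map_sub, map_add, map_mul, hP0, hα, hβ, hε, hδ1, hδ2, he1, he2, ht1, ht2,
          map_ofNat, zero_mul, mul_zero, sub_zero, add_zero]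
        constructor
        · field_simp; rw [hNdef]; ring
        · field_simp; rw [hNdef]; ring
      obtain ⟨t', ht'⟩ := (red_eq_zero_iff v).1 hv
      refine ⟨e + P • δ, t', ?_, ?_⟩
      · rw [map_add, he, add_eq_left, red_eq_zero_iff]
        exact ⟨(p : ℤ_[p]) ^ n • δ, by rw [smul_smul, hP, pow_succ']⟩
      · rw [pow_succ, mul_smul, ← ht', hst]
        ext <;> simp [sqForm, v] <;> ring
  -- The range is compact, so approximate solutions suffice and no limit of the iterates is needed.
  have hclosed : IsClosed (Set.range (sqForm α β ε)) :=
    (isCompact_range (continuous_sqForm α β ε)).isClosed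
  change s ∈ Set.range (sqForm α β ε)
  rw [← hclosed.closure_eq, Metric.mem_closure_iff]
  intro η hη
  have hp1 : ‖(p : ℤ_[p])‖ < 1 := by
    rw [PadicInt.norm_lt_one_iff_dvd]
  obtain ⟨n, hn⟩ := exists_pow_lt_of_lt_one hη hp1
  obtain ⟨e, t, -, hst⟩ := approx n
  refine ⟨_, ⟨e, rfl⟩, ?_⟩
  have hb : ∀ x : ℤ_[p], ‖(p : ℤ_[p]) ^ (n + 1) * x‖ < η := by
    intro x
    rw [norm_mul, norm_pow]
    refine lt_of_le_of_lt ?_ hn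
    calc ‖(p : ℤ_[p])‖ ^ (n + 1) * ‖x‖ ≤ ‖(p : ℤ_[p])‖ ^ (n + 1) * 1 := by
          gcongr; exact x.norm_le_one
      _ ≤ ‖(p : ℤ_[p])‖ ^ n := by
          rw [mul_one]; exact pow_le_pow_of_le_one (norm_nonneg _) hp1.le (Nat.le_succ n)
  rw [dist_eq_norm, hst, add_sub_cancel_left, Prod.norm_def, max_lt_iff]
  exact ⟨hb _, hb _⟩

/-- The vectors whose reduction is a nonzero square in `𝔽_p[x]/(x² + z)`. -/
def unitSquares (z : ZMod p) : Set (ℤ_[p] × ℤ_[p]) :=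
  red p ⁻¹' {u | ∃ e, e ≠ 0 ∧ sqForm 0 z 0 e = u}

/-- Zero, together with the products of `unitSquares` by even powers of `p`. -/
def evenSquares (z : ZMod p) : Set (ℤ_[p] × ℤ_[p]) :=
  {s | s = 0 ∨ ∃ k : ℕ, ∃ u ∈ unitSquares z, s = (p : ℤ_[p]) ^ (2 * k) • u}

lemma red_ne_zero_of_mem_unitSquares {z : ZMod p} (hz : ∀ t, t ^ 2 + z ≠ 0)
    {u : ℤ_[p] × ℤ_[p]} (hu : u ∈ unitSquares z) : red p u ≠ 0 := by
  obtain ⟨e, he, hu⟩ := hu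
  rw [← hu]
  exact fun h ↦ he (sqForm_eq_zero hz h)

/-- This self-similarity is what yields a linear equation for the measure. -/
lemma evenSquares_eq (z : ZMod p) :
    evenSquares z = unitSquares z ∪ (fun s ↦ (p : ℤ_[p]) ^ 2 • s) '' evenSquares z := by
  ext s
  constructor
  · rintro (rfl | ⟨k, u, hu, rfl⟩)
    · exact Or.inr ⟨0, Or.inl rfl, smul_zero _⟩
    · cases k with
      | zero => left; simpa using hu
      | succ k =>
        exact Or.inr ⟨(p : ℤ_[p]) ^ (2 * k) • u, Or.inr ⟨k, u, hu, rfl⟩, by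
          simp only [smul_smul, ← pow_add]; congr 2; ring⟩
  · rintro (hs | ⟨t, (rfl | ⟨k, u, hu, rfl⟩), rfl⟩)
    · exact Or.inr ⟨0, s, hs, by simp⟩
    · exact Or.inl (smul_zero _)
    · exact Or.inr ⟨k + 1, u, hu, by simp only [smul_smul, ← pow_add]; congr 2; ring⟩

/-- A nonzero `d ≡ 0` is `p ^ (k + 1) • e` with `e` nonzero modulo `p`. By `sqForm_smul` a factor `p
^ (2k + 2)` comes out and the new quartic coefficient is divisible by `p`, so what remains reduces
to a true square; Hensel's lemma gives the converse. -/
lemma exists_sqForm_eq_iff (hp : p ≠ 2) {z : ZMod p} (hz : ∀ t, t ^ 2 + z ≠ 0) {α β : ℤ_[p]}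
    (w : ℤ_[p]) (hα : PadicInt.toZMod α = 0) (hβ : PadicInt.toZMod β = z) (r : ℤ_[p] × ℤ_[p]) :
    (∃ d, red p d = 0 ∧ sqForm α β w d = r) ↔
      r ∈ (fun s ↦ (p : ℤ_[p]) ^ 2 • s) '' evenSquares z := by
  have hε (k : ℕ) : PadicInt.toZMod (((p : ℤ_[p]) ^ (k + 1)) ^ 2 * w) = 0 := by simp
  constructor
  · rintro ⟨d, hd, rfl⟩
    obtain ⟨y, rfl⟩ := (red_eq_zero_iff d).1 hd
    by_cases hy : y = 0
    · exact ⟨0, Or.inl rfl, by subst hy; ext <;> simp [sqForm]⟩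
    obtain ⟨k, e, he, rfl⟩ := exists_eq_pow_smul hy
    rw [smul_smul, ← pow_succ', sqForm_smul]
    refine ⟨_,
      Or.inr ⟨k, sqForm α β (((p : ℤ_[p]) ^ (k + 1)) ^ 2 * w) e, ⟨red p e, he, ?_⟩, rfl⟩, ?_⟩
    · rw [red_sqForm, hε, hα, hβ]
    · simp only [smul_smul]; congr 1; ring
  · rintro ⟨s, (rfl | ⟨k, u, ⟨e₀, he₀, hu⟩, rfl⟩), rfl⟩
    · exact ⟨0, map_zero _, by ext <;> simp [sqForm]⟩
    · obtain ⟨e, rfl⟩ := exists_sqForm_eq hp hz hα hβ (hε k) he₀ hu.symm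
      refine ⟨(p : ℤ_[p]) ^ (k + 1) • e, ?_, ?_⟩
      · rw [red_eq_zero_iff]
        exact ⟨(p : ℤ_[p]) ^ k • e, by rw [smul_smul, pow_succ']⟩
      · rw [sqForm_smul]
        simp only [smul_smul]; congr 1; ring

end Squares

/-! ### Haar measure of the set of even squares -/

section Measure
open TopologicalSpace

lemma isProbabilityMeasure_addHaarMeasure_top (G : Type*) [AddGroup G] [TopologicalSpace G]
    [IsTopologicalAddGroup G] [CompactSpace G] [Nonempty G] [MeasurableSpace G] [BorelSpace G] :
    IsProbabilityMeasure (Measure.addHaarMeasure (⊤ : PositiveCompacts G)) :=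
  ⟨by simpa using Measure.addHaarMeasure_self (K₀ := (⊤ : PositiveCompacts G))⟩

variable {p : ℕ} [Fact p.Prime]

instance : IsProbabilityMeasure (Measure.addHaarMeasure (⊤ : PositiveCompacts ℤ_[p])) :=
  isProbabilityMeasure_addHaarMeasure_top _

instance (n : ℕ) : IsProbabilityMeasure (haar p n) :=
  isProbabilityMeasure_addHaarMeasure_top _

instance (n : ℕ) : (haar p n).IsAddHaarMeasure := by unfold haar; infer_instance

/-- The normalised Haar measure on `ℤ_[p] × ℤ_[p]`. -/
noncomputable def haarProd (p : ℕ) [Fact p.Prime] : Measure (ℤ_[p] × ℤ_[p]) :=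
  (Measure.addHaarMeasure ⊤).prod (Measure.addHaarMeasure ⊤)

instance : IsProbabilityMeasure (haarProd p) := by unfold haarProd; infer_instance

instance : (haarProd p).IsAddHaarMeasure := by unfold haarProd; infer_instance

lemma continuous_toZMod : Continuous (PadicInt.toZMod : ℤ_[p] → ZMod p) := by
  refine (IsLocallyConstant.iff_eventually_eq _ |>.2 fun x ↦ ?_).continuous
  filter_upwards [Metric.ball_mem_nhds x one_pos] with y hy
  rw [← sub_eq_zero, ← map_sub, toZMod_eq_zero_iff, ← PadicInt.norm_lt_one_iff_dvd]
  simpa [dist_eq_norm] using hy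

lemma continuous_red : Continuous (red p) :=
  (continuous_toZMod.comp continuous_fst).prodMk (continuous_toZMod.comp continuous_snd)

lemma measurableSet_preimage_red (A : Set (ZMod p × ZMod p)) : MeasurableSet (red p ⁻¹' A) :=
  ((isOpen_discrete A).preimage continuous_red).measurableSet

lemma haarProd_real_preimage_red_singleton (u : ZMod p × ZMod p) :
    (haarProd p).real (red p ⁻¹' {u}) = 1 / (p : ℝ) ^ 2 := by
  have key : ∀ u, (haarProd p).real (red p ⁻¹' {u}) = (haarProd p).real (red p ⁻¹' {0}) := by
    intro u
    obtain ⟨x, hx⟩ := red_surjective u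
    have : red p ⁻¹' {u} = (fun y ↦ -x + y) ⁻¹' (red p ⁻¹' {0}) := by
      ext y
      rw [Set.mem_preimage, Set.mem_preimage, Set.mem_preimage, map_add, map_neg, hx,
        Set.mem_singleton_iff, Set.mem_singleton_iff, neg_add_eq_zero, eq_comm]
    rw [this, measureReal_def, measureReal_def, measure_preimage_add]
  have hsum := sum_measureReal_preimage_singleton (μ := haarProd p) (f := red p) Finset.univ
    (fun y _ ↦ measurableSet_preimage_red {y})
  have hp : (p : ℝ) ≠ 0 := by exact_mod_cast (Fact.out : p.Prime).ne_zero
  simp only [key, Finset.sum_const, Finset.coe_univ, Set.preimage_univ, Finset.card_univ,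
    Fintype.card_prod, ZMod.card, nsmul_eq_mul, probReal_univ] at hsum
  rw [key, eq_div_iff (by positivity), ← hsum]
  push_cast; ring

lemma haarProd_real_preimage_red (A : Finset (ZMod p × ZMod p)) :
    (haarProd p).real (red p ⁻¹' A) = A.card / (p : ℝ) ^ 2 := by
  rw [← sum_measureReal_preimage_singleton _ (fun y _ ↦ measurableSet_preimage_red {y})]
  simp only [haarProd_real_preimage_red_singleton, Finset.sum_const, nsmul_eq_mul]
  ring

lemma measurableEmbedding_smul :
    MeasurableEmbedding (fun s : ℤ_[p] × ℤ_[p] ↦ (p : ℤ_[p]) • s) := by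
  refine (Continuous.isClosedEmbedding (by fun_prop) ?_).measurableEmbedding
  exact smul_right_injective _ (by exact_mod_cast (Fact.out : p.Prime).ne_zero)

/-- The pullback of Haar measure along multiplication by `p` is translation invariant, hence a
multiple of Haar measure; the whole space gives the factor. -/
lemma haarProd_real_image_smul (A : Set (ℤ_[p] × ℤ_[p])) :
    (haarProd p).real ((fun s ↦ (p : ℤ_[p]) • s) '' A) = (haarProd p).real A / (p : ℝ) ^ 2 := by
  let f : ℤ_[p] × ℤ_[p] →+ ℤ_[p] × ℤ_[p] := DistribSMul.toAddMonoidHom _ (p : ℤ_[p])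
  have hf : MeasurableEmbedding f := measurableEmbedding_smul
  let ν := (haarProd p).comap f
  have hν (B) : ν B = (haarProd p) (f '' B) := hf.comap_apply _ _
  have : ν.IsAddLeftInvariant := Measure.IsAddLeftInvariant.comap _ hf
  have : IsFiniteMeasure ν := ⟨by rw [hν]; exact measure_lt_top _ _⟩
  have h := Measure.isAddLeftInvariant_eq_smul ν (haarProd p)
  set c := ν.addHaarScalarFactor (haarProd p)
  have hc (B : Set (ℤ_[p] × ℤ_[p])) : (haarProd p).real (f '' B) = c * (haarProd p).real B := by
    rw [measureReal_def, ← hν, h, measureReal_def, Measure.smul_apply, ENNReal.smul_def,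
      smul_eq_mul, ENNReal.toReal_mul, ENNReal.coe_toReal]
  have h1 := hc Set.univ
  have h2 : f '' Set.univ = red p ⁻¹' {0} := by
    ext s
    rw [Set.image_univ, Set.mem_preimage, Set.mem_singleton_iff, red_eq_zero_iff]
    exact exists_congr fun _ ↦ eq_comm
  rw [h2, haarProd_real_preimage_red_singleton, probReal_univ, mul_one] at h1
  have h3 := hc A
  rw [← h1] at h3
  exact h3.trans (by ring)

lemma haarProd_real_image_sq_smul (A : Set (ℤ_[p] × ℤ_[p])) :
    (haarProd p).real ((fun s ↦ (p : ℤ_[p]) ^ 2 • s) '' A) = (haarProd p).real A / (p : ℝ) ^ 4 := by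
  have : (fun s : ℤ_[p] × ℤ_[p] ↦ (p : ℤ_[p]) ^ 2 • s) =
      (fun s ↦ (p : ℤ_[p]) • s) ∘ (fun s ↦ (p : ℤ_[p]) • s) := by
    ext s <;> simp [pow_two, mul_assoc]
  rw [this, Set.image_comp, haarProd_real_image_smul, haarProd_real_image_smul]
  ring

/-- In the field `𝔽_p[x]/(x² + z)`, half of the nonzero elements are squares. -/
lemma two_mul_card_squares (hp : p ≠ 2) {z : ZMod p} (hz : ∀ t, t ^ 2 + z ≠ 0)
    [DecidableEq (ZMod p × ZMod p)] :
    2 * ((Finset.univ.erase (0 : ZMod p × ZMod p)).image (sqForm 0 z 0)).card + 1 = p ^ 2 := by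
  have h2 : (2 : ZMod p) ≠ 0 := Ring.two_ne_zero (by rwa [ZMod.ringChar_zmod_n])
  have h := Finset.card_eq_sum_card_image (sqForm 0 z 0) (Finset.univ.erase (0 : ZMod p × ZMod p))
  -- Squaring is two-to-one on nonzero elements, with fibres `{e, -e}`.
  have hfib : ∀ b ∈ (Finset.univ.erase (0 : ZMod p × ZMod p)).image (sqForm 0 z 0),
      ((Finset.univ.erase (0 : ZMod p × ZMod p)).filter (sqForm 0 z 0 · = b)).card = 2 := by
    intro b hb
    obtain ⟨e, he, rfl⟩ := Finset.mem_image.1 hb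
    have he0 : e ≠ 0 := Finset.ne_of_mem_erase he
    have : (Finset.univ.erase (0 : ZMod p × ZMod p)).filter (sqForm 0 z 0 · = sqForm 0 z 0 e)
        = {e, -e} := by
      ext x
      simp only [Finset.mem_filter, Finset.mem_erase, Finset.mem_univ, and_true,
        Finset.mem_insert, Finset.mem_singleton]
      constructor
      · rintro ⟨-, hx⟩
        exact eq_or_eq_neg_of_sqForm_eq hz hx
      · rintro (rfl | rfl)
        · exact ⟨he0, rfl⟩
        · exact ⟨neg_ne_zero.2 he0, sqForm_neg ..⟩
    rw [this, Finset.card_pair]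
    intro hee
    apply he0
    have h1 : 2 * e.1 = 0 := by
      rw [two_mul, ← eq_neg_iff_add_eq_zero]; exact congrArg Prod.fst hee
    have h3 : 2 * e.2 = 0 := by
      rw [two_mul, ← eq_neg_iff_add_eq_zero]; exact congrArg Prod.snd hee
    exact Prod.ext ((mul_eq_zero.1 h1).resolve_left h2) ((mul_eq_zero.1 h3).resolve_left h2)
  rw [Finset.sum_congr rfl hfib, Finset.card_erase_of_mem (Finset.mem_univ _), Finset.sum_const,
    Finset.card_univ, Fintype.card_prod, ZMod.card, smul_eq_mul] at h
  have : 0 < p * p := Nat.mul_pos (Fact.out : p.Prime).pos (Fact.out : p.Prime).pos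
  rw [pow_two]; omega

lemma haarProd_real_unitSquares (hp : p ≠ 2) {z : ZMod p} (hz : ∀ t, t ^ 2 + z ≠ 0) :
    (haarProd p).real (unitSquares z) = ((p : ℝ) ^ 2 - 1) / (2 * (p : ℝ) ^ 2) := by
  classical
  have hA : unitSquares z =
      red p ⁻¹' ((Finset.univ.erase (0 : ZMod p × ZMod p)).image (sqForm 0 z 0)) := by
    simp [unitSquares, Set.image]
  have hcard := congrArg (Nat.cast : ℕ → ℝ) (two_mul_card_squares hp hz)
  push_cast at hcard
  rw [hA, haarProd_real_preimage_red]
  have hp0 : (p : ℝ) ≠ 0 := by exact_mod_cast (Fact.out : p.Prime).ne_zero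
  field_simp
  linarith

lemma measurableSet_evenSquares (z : ZMod p) : MeasurableSet (evenSquares z) := by
  have : evenSquares z =
      {0} ∪ ⋃ k : ℕ, (fun s ↦ (p : ℤ_[p]) ^ (2 * k) • s) '' unitSquares z := by
    ext s
    simp [evenSquares, eq_comm]
  rw [this]
  refine (measurableSet_singleton _).union (.iUnion fun k ↦ ?_)
  have hU : IsClosed (unitSquares z) := (isClosed_discrete _).preimage continuous_red
  exact (hU.isCompact.image (by fun_prop)).isClosed.measurableSet

lemma measurableSet_image_sq_smul_evenSquares (z : ZMod p) :
    MeasurableSet ((fun s ↦ (p : ℤ_[p]) ^ 2 • s) '' evenSquares z) := by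
  have : (fun s : ℤ_[p] × ℤ_[p] ↦ (p : ℤ_[p]) ^ 2 • s) =
      (fun s ↦ (p : ℤ_[p]) • s) ∘ (fun s ↦ (p : ℤ_[p]) • s) := by
    ext s <;> simp [pow_two, mul_assoc]
  rw [this]
  exact (measurableEmbedding_smul.comp measurableEmbedding_smul).measurableSet_image.2
    (measurableSet_evenSquares z)

/-- Solve `m = (p² - 1)/(2p²) + m/p⁴`, cancelling `p² - 1` from `p⁴ - 1`. -/
lemma haarProd_real_evenSquares (hp : p ≠ 2) {z : ZMod p} (hz : ∀ t, t ^ 2 + z ≠ 0) :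
    (haarProd p).real (evenSquares z) = (p : ℝ) ^ 2 / (2 * ((p : ℝ) ^ 2 + 1)) := by
  have hdisj : Disjoint (unitSquares z) ((fun s ↦ (p : ℤ_[p]) ^ 2 • s) '' evenSquares z) := by
    rw [Set.disjoint_left]
    rintro _ hu ⟨t, -, rfl⟩
    refine red_ne_zero_of_mem_unitSquares hz hu ((red_eq_zero_iff _).2 ⟨(p : ℤ_[p]) • t, ?_⟩)
    rw [smul_smul, pow_two]
  have h := congrArg (haarProd p).real (evenSquares_eq z)
  rw [measureReal_union hdisj (measurableSet_image_sq_smul_evenSquares z),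
    haarProd_real_unitSquares hp hz, haarProd_real_image_sq_smul] at h
  have hp1 : (1 : ℝ) < p := by exact_mod_cast (Fact.out : p.Prime).one_lt
  have hp2 : (p : ℝ) ^ 2 - 1 ≠ 0 := by nlinarith
  field_simp at h ⊢
  apply mul_left_cancel₀ hp2
  linear_combination h

/-- Fubini: over each `y ∈ Y` the section is the preimage of `T` under the measure-preserving
reflection `s ↦ σ y - s`. -/
lemma measure_prod_shear {G : Type*} [MeasurableSpace G] (μ : Measure G) [SFinite μ]
    {Y : Set G} (hY : MeasurableSet Y) {σ : G → ℤ_[p] × ℤ_[p]} (hσ : Measurable σ)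
    {T : Set (ℤ_[p] × ℤ_[p])} (hT : MeasurableSet T) :
    (μ.prod (haarProd p)).real {x | x.1 ∈ Y ∧ σ x.1 - x.2 ∈ T} =
      μ.real Y * (haarProd p).real T := by
  have hmeas : MeasurableSet {x : G × (ℤ_[p] × ℤ_[p]) | x.1 ∈ Y ∧ σ x.1 - x.2 ∈ T} :=
    (measurable_fst hY).inter (((hσ.comp measurable_fst).sub measurable_snd) hT)
  have hsec : ∀ y, haarProd p (Prod.mk y ⁻¹' {x | x.1 ∈ Y ∧ σ x.1 - x.2 ∈ T}) =
      Y.indicator (fun _ ↦ haarProd p T) y := by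
    intro y
    by_cases hy : y ∈ Y
    · rw [Set.indicator_of_mem hy,
        ← (Measure.measurePreserving_sub_left (haarProd p) (σ y)).measure_preimage
          hT.nullMeasurableSet]
      congr 1
      ext s
      simp [hy]
    · simp [hy]
  simp only [measureReal_def]
  rw [Measure.prod_apply hmeas, lintegral_congr hsec, lintegral_indicator_const hY,
    ENNReal.toReal_mul, mul_comm]

end Measure

/-! ### Factorisations of quartics -/

section Quartics
variable {p : ℕ} [Fact p.Prime]

lemma tracelessQuartic_eq (c : Fin 3 → ℤ_[p]) :
    tracelessQuartic c = monicQuartic ![c 0, c 1, c 2, 0] := by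
  simp [tracelessQuartic, monicQuartic]

lemma sq_eq_monicQuartic (ζ : ℤ_[p]) :
    (X ^ 2 + C ζ) ^ 2 = monicQuartic ![ζ ^ 2, 0, 2 * ζ, 0] := by
  simp only [monicQuartic, Matrix.cons_val, map_mul, map_pow, map_zero, map_ofNat]
  ring

lemma coeff_monicQuartic (c : Fin 4 → ℤ_[p]) (i : Fin 4) : (monicQuartic c).coeff i = c i := by
  fin_cases i <;> simp [monicQuartic, coeff_X, coeff_C]

lemma monic_monicQuartic (c : Fin 4 → ℤ_[p]) : (monicQuartic c).Monic := by
  unfold monicQuartic; monicity!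

lemma natDegree_monicQuartic (c : Fin 4 → ℤ_[p]) : (monicQuartic c).natDegree = 4 := by
  unfold monicQuartic; compute_degree!

lemma monicQuartic_injective : Function.Injective (monicQuartic (p := p)) := fun c c' h ↦ by
  ext1 i
  rw [← coeff_monicQuartic c, h, coeff_monicQuartic]

lemma congrModP_monicQuartic_iff (c c' : Fin 4 → ℤ_[p]) :
    CongrModP (monicQuartic c) (monicQuartic c') ↔
      ∀ i, PadicInt.toZMod (c i) = PadicInt.toZMod (c' i) := by
  constructor
  · intro h i
    have := congrArg (coeff · (i : ℕ)) h
    simpa [coeff_monicQuartic] using this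
  · intro h
    simp [CongrModP, monicQuartic, Polynomial.map_add, Polynomial.map_mul, h]

/-- The coefficients of `(x² + a x + b) (x² + a' x + b')`, for `t = (a, b, a', b')`. -/
noncomputable def mulQuadratic (t : Fin 4 → ℤ_[p]) : Fin 4 → ℤ_[p] :=
  ![t 1 * t 3, t 0 * t 3 + t 2 * t 1, t 1 + t 3 + t 0 * t 2, t 0 + t 2]

/-- The coefficients of `(x + a) (x³ + u x² + v x + w)`, for `t = (a, u, v, w)`. -/
noncomputable def mulLinear (t : Fin 4 → ℤ_[p]) : Fin 4 → ℤ_[p] :=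
  ![t 0 * t 3, t 3 + t 0 * t 2, t 2 + t 0 * t 1, t 1 + t 0]

lemma monicQuartic_mulQuadratic (t : Fin 4 → ℤ_[p]) :
    monicQuartic (mulQuadratic t) =
      (X ^ 2 + C (t 0) * X + C (t 1)) * (X ^ 2 + C (t 2) * X + C (t 3)) := by
  simp only [monicQuartic, mulQuadratic, Matrix.cons_val, map_mul, map_add]
  ring

lemma monicQuartic_mulLinear (t : Fin 4 → ℤ_[p]) :
    monicQuartic (mulLinear t) =
      (X + C (t 0)) * (X ^ 3 + C (t 1) * X ^ 2 + C (t 2) * X + C (t 3)) := by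
  simp only [monicQuartic, mulLinear, Matrix.cons_val, map_mul, map_add]
  ring

/-- Some monic factor has degree 1 or 2. Phrasing this through ranges of polynomial maps on a
compact space makes the reducible locus closed. -/
lemma not_irreducible_monicQuartic_iff (c : Fin 4 → ℤ_[p]) :
    ¬ Irreducible (monicQuartic c) ↔ c ∈ Set.range mulLinear ∪ Set.range mulQuadratic := by
  have h1 : monicQuartic c ≠ 1 := fun h ↦ by
    simpa [h] using natDegree_monicQuartic c
  rw [(monic_monicQuartic c).irreducible_iff_natDegree', and_iff_right h1,
    natDegree_monicQuartic]
  push Not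
  constructor
  · rintro ⟨f, g, hf, hg, hfg, hd⟩
    have hadd := natDegree_monicQuartic c
    rw [← hfg, hf.natDegree_mul hg] at hadd
    rw [Finset.mem_Ioc] at hd
    have hd' : g.natDegree = 1 ∨ g.natDegree = 2 := by omega
    rcases hd' with h | h
    · left
      have h3 : f.natDegree = 3 := by omega
      have ef := hf.as_sum
      have eg := hg.as_sum
      rw [h3] at ef
      rw [h] at eg
      refine ⟨![g.coeff 0, f.coeff 2, f.coeff 1, f.coeff 0], monicQuartic_injective ?_⟩
      rw [monicQuartic_mulLinear, ← hfg, ef, eg]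
      simp [Finset.sum_range_succ, -map_add]
      ring
    · right
      have h3 : f.natDegree = 2 := by omega
      have ef := hf.as_sum
      have eg := hg.as_sum
      rw [h3] at ef
      rw [h] at eg
      refine ⟨![g.coeff 1, g.coeff 0, f.coeff 1, f.coeff 0], monicQuartic_injective ?_⟩
      rw [monicQuartic_mulQuadratic, ← hfg, ef, eg]
      simp [Finset.sum_range_succ, -map_add]
      ring
  · rintro (⟨t, rfl⟩ | ⟨t, rfl⟩)
    · refine ⟨_, _, ?_, ?_, (mul_comm _ _).trans (monicQuartic_mulLinear t).symm, ?_⟩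
      · monicity!
      · monicity!
      · rw [natDegree_X_add_C]; decide
    · refine ⟨_, _, ?_, ?_, (monicQuartic_mulQuadratic t).symm, ?_⟩
      · monicity!
      · monicity!
      · have : (X ^ 2 + C (t 2) * X + C (t 3)).natDegree = 2 := by compute_degree!
        rw [this]; decide

lemma continuous_mulLinear : Continuous (mulLinear (p := p)) := by
  refine continuous_pi fun i ↦ ?_
  fin_cases i <;> simp [mulLinear] <;> fun_prop

lemma continuous_mulQuadratic : Continuous (mulQuadratic (p := p)) := by
  refine continuous_pi fun i ↦ ?_
  fin_cases i <;> simp [mulQuadratic] <;> fun_prop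

lemma isOpen_irreducible_monicQuartic :
    IsOpen {c : Fin 4 → ℤ_[p] | Irreducible (monicQuartic c)} := by
  have : {c : Fin 4 → ℤ_[p] | Irreducible (monicQuartic c)} =
      (Set.range mulLinear ∪ Set.range mulQuadratic)ᶜ := by
    ext c
    rw [Set.mem_compl_iff, ← not_irreducible_monicQuartic_iff, not_not, Set.mem_ofPred_eq]
  rw [this]
  exact ((isCompact_range continuous_mulLinear).isClosed.union
    (isCompact_range continuous_mulQuadratic).isClosed).isOpen_compl

lemma isOpen_irreducible_tracelessQuartic :
    IsOpen {c : Fin 3 → ℤ_[p] | Irreducible (tracelessQuartic c)} := by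
  simp only [tracelessQuartic_eq]
  refine isOpen_irreducible_monicQuartic.preimage
    (f := fun c : Fin 3 → ℤ_[p] ↦ ![c 0, c 1, c 2, 0]) (continuous_pi fun i ↦ ?_)
  fin_cases i <;> simp <;> fun_prop

section Field
variable {K : Type*} [Field K] {z : K}

/-- Evaluating `(x² + z)²` at the root `-a` gives `(a² + z)² = 0`. -/
lemma linear_mul_cubic_ne (hz : ∀ t : K, t ^ 2 + z ≠ 0) {a u v w : K} (h0 : a * w = z ^ 2)
    (h1 : w + a * v = 0) (h2 : v + a * u = 2 * z) (h3 : u + a = 0) : False := by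
  apply hz a
  apply pow_eq_zero_iff (two_ne_zero) |>.1
  linear_combination -h0 + a * h1 - a ^ 2 * h2 + a ^ 3 * h3

/-- An instance of unique factorisation for `(x² + z)²`, done by hand on coefficients. -/
lemma quadratic_mul_quadratic_eq (h2 : (2 : K) ≠ 0) (hz : ∀ t : K, t ^ 2 + z ≠ 0) {a b a' b' : K}
    (h0 : b * b' = z ^ 2) (h1 : a * b' + a' * b = 0) (h2' : b + b' + a * a' = 2 * z)
    (h3 : a + a' = 0) : a = a' ∧ b = b' := by
  have ha' : a' = -a := by linear_combination h3
  subst ha'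
  have h : a * (b' - b) = 0 := by linear_combination h1
  rcases mul_eq_zero.1 h with rfl | h
  · have : (b - b') ^ 2 = 0 := by linear_combination (b + b' + 2 * z) * h2' - 4 * h0
    exact ⟨by simp, sub_eq_zero.1 (pow_eq_zero_iff (two_ne_zero) |>.1 this)⟩
  · have hb : b' = b := sub_eq_zero.1 h
    subst hb
    have : (b' - z) * (b' + z) = 0 := by linear_combination h0
    rcases mul_eq_zero.1 this with hb | hb
    · have ha : a ^ 2 = 0 := by linear_combination 2 * hb - h2'
      have ha : a = 0 := pow_eq_zero_iff (two_ne_zero) |>.1 ha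
      simp [ha]
    -- Here `b = b' = -z`, so `a² = -4z` and `a / 2` is a root of `x² + z`.
    · exfalso
      apply hz (a / 2)
      field_simp
      linear_combination 2 * hb - h2'

end Field

/-- The pair on the right is `r = g² - f`. Expanding `(g + w d₁²)² - (d₁ x + d₀)²` with `w = 1/2`
gives `r = sqForm α β (w²) d`. -/
lemma not_irreducible_iff_mem_evenSquares (hp : p ≠ 2) {z : ZMod p} (hz : ∀ t, t ^ 2 + z ≠ 0)
    {w : ℤ_[p]} (hw : 2 * w = 1) (c : Fin 4 → ℤ_[p])
    (h3 : PadicInt.toZMod (c 3) = 0) (h2 : PadicInt.toZMod (c 2) = 2 * z)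
    (h1 : PadicInt.toZMod (c 1) = 0) (h0 : PadicInt.toZMod (c 0) = z ^ 2)
    {α β : ℤ_[p]} (hα : c 3 = 2 * α) (hβ : c 2 = α ^ 2 + 2 * β) :
    ¬ Irreducible (monicQuartic c) ↔ ((2 * α * β, β ^ 2) - (c 1, c 0) : ℤ_[p] × ℤ_[p]) ∈
      (fun s ↦ (p : ℤ_[p]) ^ 2 • s) '' evenSquares z := by
  have h20 : (2 : ZMod p) ≠ 0 := Ring.two_ne_zero (by rwa [ZMod.ringChar_zmod_n])
  have h2inj : ∀ {x y : ℤ_[p]}, 2 * x = 2 * y → x = y := fun h ↦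
    mul_left_cancel₀ (two_ne_zero) h
  have hα0 : PadicInt.toZMod α = 0 := by
    rw [hα, map_mul, map_ofNat] at h3
    exact (mul_eq_zero.1 h3).resolve_left h20
  have hβ0 : PadicInt.toZMod β = z := by
    rw [hβ, map_add, map_mul, map_pow, map_ofNat, hα0] at h2
    exact mul_left_cancel₀ h20 (by linear_combination h2)
  rw [not_irreducible_monicQuartic_iff, ← exists_sqForm_eq_iff hp hz (w ^ 2) hα0 hβ0]
  constructor
  · rintro (⟨t, rfl⟩ | ⟨t, rfl⟩)
    · simp only [mulLinear, Matrix.cons_val, map_add, map_mul] at h0 h1 h2 h3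
      exact (linear_mul_cubic_ne hz h0 h1 h2 h3).elim
    · simp only [mulQuadratic, Matrix.cons_val, map_add, map_mul] at h0 h1 h2 h3 hα hβ
      obtain ⟨ea, eb⟩ := quadratic_mul_quadratic_eq h20 hz h0 h1 h2 h3
      have ht2 : t 2 = 2 * α - t 0 := by linear_combination hα
      have ht3 : t 3 = α ^ 2 + 2 * β - t 1 - t 0 * t 2 := by linear_combination hβ
      have hhalf : ∀ {x y x' : ℤ_[p]}, 2 * x = y - x' →
          PadicInt.toZMod y = PadicInt.toZMod x' → PadicInt.toZMod x = 0 := by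
        intro x y x' h h'
        have := congrArg PadicInt.toZMod h
        rw [map_sub, h', sub_self, map_mul, map_ofNat] at this
        exact (mul_eq_zero.1 this).resolve_left h20
      -- Half the difference of the two factors. Their constant terms sum to `2β + d₁²`, whence the
      -- correction `w d₁²`; `d ≡ 0` because the factors agree modulo `p`.
      refine ⟨(t 0 - α, t 1 - β - w * (t 0 - α) ^ 2), ?_, ?_⟩
      · rw [red_apply, Prod.mk_eq_zero]
        refine ⟨hhalf ?_ ea, hhalf ?_ eb⟩
        · rw [ht2]; ring
        · rw [ht3, ht2]; linear_combination (-(t 0 - α) ^ 2) * hw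
      · simp only [sqForm, mulQuadratic, Matrix.cons_val, Prod.mk_sub_mk, Prod.mk.injEq]
        rw [ht3, ht2]
        constructor
        · linear_combination (-(t 0 - α) ^ 3) * hw
        · linear_combination (-(t 1 - β) * (t 0 - α) ^ 2) * hw
  · rintro ⟨d, -, hd⟩
    right
    simp only [sqForm, Prod.mk_sub_mk, Prod.mk.injEq] at hd
    obtain ⟨hd1, hd2⟩ := hd
    refine ⟨![α + d.1, β + w * d.1 ^ 2 + d.2, α - d.1, β + w * d.1 ^ 2 - d.2], ?_⟩
    ext1 i
    fin_cases i
    · simp only [mulQuadratic, Matrix.cons_val, Fin.zero_eta]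
      linear_combination β * d.1 ^ 2 * hw - hd2
    · simp only [mulQuadratic, Matrix.cons_val, Fin.mk_one]
      linear_combination α * d.1 ^ 2 * hw - hd1
    · simp only [mulQuadratic, Matrix.cons_val, Fin.reduceFinMk]
      linear_combination d.1 ^ 2 * hw - hβ
    · simp only [mulQuadratic, Matrix.cons_val, Fin.reduceFinMk]
      linear_combination -hα

/-- The proportion of irreducible polynomials in a family `D` which fibres over `Y` through the
measure-preserving coordinates `e`. -/
lemma proportion_eq (hp : p ≠ 2) {z : ZMod p} (hz : ∀ t, t ^ 2 + z ≠ 0) {n : ℕ} {G : Type*}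
    [MeasurableSpace G] {μ : Measure G} [IsFiniteMeasure μ]
    {e : (Fin n → ℤ_[p]) → G × (ℤ_[p] × ℤ_[p])}
    (he : MeasurePreserving e (haar p n) (μ.prod (haarProd p))) {Y : Set G} (hY : MeasurableSet Y)
    (hY0 : μ.real Y ≠ 0) {σ : G → ℤ_[p] × ℤ_[p]} (hσ : Measurable σ)
    {D S : Set (Fin n → ℤ_[p])} (hS : MeasurableSet S)
    (hD : ∀ c, c ∈ D ↔ (e c).1 ∈ Y ∧ red p (σ (e c).1 - (e c).2) = 0)
    (hDS : ∀ c ∈ D, c ∉ S ↔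
      σ (e c).1 - (e c).2 ∈ (fun s ↦ (p : ℤ_[p]) ^ 2 • s) '' evenSquares z) :
    proportion D S = (2 * (p : ℝ) ^ 2 + 1) / (2 * ((p : ℝ) ^ 2 + 1)) := by
  have hmeas (T : Set (ℤ_[p] × ℤ_[p])) (hT : MeasurableSet T) :
      (haar p n).real (e ⁻¹' {x | x.1 ∈ Y ∧ σ x.1 - x.2 ∈ T}) =
        μ.real Y * (haarProd p).real T := by
    rw [← measure_prod_shear μ hY hσ hT, measureReal_def, measureReal_def, he.measure_preimage]
    exact ((measurable_fst hY).inter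
      (((hσ.comp measurable_fst).sub measurable_snd) hT)).nullMeasurableSet
  have hD' : D = e ⁻¹' {x | x.1 ∈ Y ∧ σ x.1 - x.2 ∈ red p ⁻¹' {0}} := by
    ext c; exact hD c
  have hDS' : D \ S = e ⁻¹' {x | x.1 ∈ Y ∧
      σ x.1 - x.2 ∈ (fun s ↦ (p : ℤ_[p]) ^ 2 • s) '' evenSquares z} := by
    ext c
    constructor
    · rintro ⟨h, h'⟩
      exact ⟨((hD c).1 h).1, (hDS c h).1 h'⟩
    · rintro ⟨h, h'⟩
      -- Elements of `p² E` already vanish modulo `p`, so the residue condition is automatic.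
      have hc : c ∈ D := by
        refine (hD c).2 ⟨h, ?_⟩
        obtain ⟨t, -, ht⟩ := h'
        exact (red_eq_zero_iff _).2 ⟨(p : ℤ_[p]) • t, by rw [← ht, smul_smul, pow_two]⟩
      exact ⟨hc, (hDS c hc).2 h'⟩
  have hsplit := measureReal_inter_add_sdiff (μ := haar p n) (s := D) hS
  have mD : (haar p n).real D = μ.real Y * (1 / (p : ℝ) ^ 2) := by
    rw [hD', hmeas _ (measurableSet_preimage_red _), haarProd_real_preimage_red_singleton]
  have mDS : (haar p n).real (D \ S) =
      μ.real Y * ((p : ℝ) ^ 2 / (2 * ((p : ℝ) ^ 2 + 1)) / (p : ℝ) ^ 4) := by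
    rw [hDS', hmeas _ (measurableSet_image_sq_smul_evenSquares z), haarProd_real_image_sq_smul,
      haarProd_real_evenSquares hp hz]
  have hp0 : (p : ℝ) ≠ 0 := by exact_mod_cast (Fact.out : p.Prime).ne_zero
  -- The factor `μ(Y)` cancels, leaving `1 - 1/(2(p² + 1))`.
  rw [proportion, eq_sub_of_add_eq hsplit, mD, mDS]
  field_simp
  ring

/-- Splitting the four coefficients into the two leading and the two trailing ones. -/
noncomputable def splitFour (p : ℕ) [Fact p.Prime] :
    (Fin 4 → ℤ_[p]) →+ (ℤ_[p] × ℤ_[p]) × (ℤ_[p] × ℤ_[p]) where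
  toFun c := ((c 3, c 2), (c 1, c 0))
  map_zero' := rfl
  map_add' _ _ := rfl

/-- Splitting the three coefficients into the leading one and the two trailing ones. -/
noncomputable def splitThree (p : ℕ) [Fact p.Prime] :
    (Fin 3 → ℤ_[p]) →+ ℤ_[p] × (ℤ_[p] × ℤ_[p]) where
  toFun c := (c 2, (c 1, c 0))
  map_zero' := rfl
  map_add' _ _ := rfl

/-- A continuous surjective homomorphism of compact groups carries normalised Haar measure to
normalised Haar measure. -/
lemma measurePreserving_splitFour :
    MeasurePreserving (splitFour p) (haar p 4) ((haarProd p).prod (haarProd p)) := by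
  have : ((haarProd p).prod (haarProd p)).IsAddHaarMeasure :=
    Measure.prod.instIsAddHaarMeasure _ _
  refine AddMonoidHom.measurePreserving ?_ ?_ (by simp)
  · change Continuous fun c : Fin 4 → ℤ_[p] ↦ ((c 3, c 2), (c 1, c 0))
    fun_prop
  · exact fun x ↦ ⟨![x.2.2, x.2.1, x.1.2, x.1.1], rfl⟩

lemma measurePreserving_splitThree :
    MeasurePreserving (splitThree p) (haar p 3)
      ((Measure.addHaarMeasure ⊤).prod (haarProd p)) := by
  refine AddMonoidHom.measurePreserving ?_ ?_ (by simp)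
  · change Continuous fun c : Fin 3 → ℤ_[p] ↦ (c 2, (c 1, c 0))
    fun_prop
  · exact fun x ↦ ⟨![x.2.2, x.2.1, x.1], rfl⟩

lemma sq_add_ne_zero_of_irreducible {ζ : ℤ_[p]}
    (hζ : Irreducible ((X ^ 2 + C ζ : ℤ_[p][X]).map PadicInt.toZMod)) (t : ZMod p) :
    t ^ 2 + PadicInt.toZMod ζ ≠ 0 := by
  intro h
  have hd : ((X ^ 2 + C ζ : ℤ_[p][X]).map PadicInt.toZMod).natDegree = 2 := by
    simp only [Polynomial.map_add, Polynomial.map_pow, map_X, map_C]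
    compute_degree!
  refine hζ.not_isRoot_of_natDegree_ne_one (by omega) (x := t) ?_
  simpa [IsRoot] using h

lemma exists_two_mul_eq_one (hp : p ≠ 2) : ∃ w : ℤ_[p], 2 * w = 1 := by
  have h20 : (2 : ZMod p) ≠ 0 := Ring.two_ne_zero (by rwa [ZMod.ringChar_zmod_n])
  have : IsUnit (2 : ℤ_[p]) := by
    by_contra h
    rw [PadicInt.not_isUnit_iff, PadicInt.norm_lt_one_iff_dvd, ← toZMod_eq_zero_iff,
      map_ofNat] at h
    exact h20 h
  exact this.exists_right_inv

lemma congrModP_sq_iff (ζ : ℤ_[p]) (c : Fin 4 → ℤ_[p]) :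
    CongrModP (monicQuartic c) ((X ^ 2 + C ζ) ^ 2) ↔
      (PadicInt.toZMod (c 3) = 0 ∧ PadicInt.toZMod (c 2) = 2 * PadicInt.toZMod ζ) ∧
        PadicInt.toZMod (c 1) = 0 ∧ PadicInt.toZMod (c 0) = PadicInt.toZMod ζ ^ 2 := by
  rw [sq_eq_monicQuartic, congrModP_monicQuartic_iff]
  simp [Fin.forall_fin_succ, map_ofNat]
  tauto

/-- Completing the square does not change the condition on the trailing coefficients. -/
lemma red_sub_eq_zero_iff {z : ZMod p} {α β c₁ c₀ : ℤ_[p]} (hα : PadicInt.toZMod α = 0)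
    (hβ : PadicInt.toZMod β = z) :
    red p ((2 * α * β, β ^ 2) - (c₁, c₀)) = 0 ↔
      PadicInt.toZMod c₁ = 0 ∧ PadicInt.toZMod c₀ = z ^ 2 := by
  rw [red_apply, Prod.mk_eq_zero]
  simp [hα, hβ, sub_eq_zero, eq_comm (a := z ^ 2)]

/-! ### The two families of quartics -/

theorem proportion_monicQuartic (hp : p ≠ 2) {ζ : ℤ_[p]}
    (hz : ∀ t, t ^ 2 + PadicInt.toZMod ζ ≠ 0) :
    proportion {c : Fin 4 → ℤ_[p] | CongrModP (monicQuartic c) ((X ^ 2 + C ζ) ^ 2)}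
      {c | Irreducible (monicQuartic c)} = (2 * (p : ℝ) ^ 2 + 1) / (2 * ((p : ℝ) ^ 2 + 1)) := by
  obtain ⟨w, hw⟩ := exists_two_mul_eq_one hp
  have hw' : 2 * PadicInt.toZMod w = 1 := by
    rw [← map_ofNat (PadicInt.toZMod (p := p)) 2, ← map_mul, hw, map_one]
  have hp0 : (p : ℝ) ≠ 0 := by exact_mod_cast (Fact.out : p.Prime).ne_zero
  -- Completing the square: `α = c₃/2` and `β = (c₂ - α²)/2`; `σ` lists the two lowest coefficients
  -- of `g²`.
  let α (y : ℤ_[p] × ℤ_[p]) : ℤ_[p] := w * y.1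
  let β (y : ℤ_[p] × ℤ_[p]) : ℤ_[p] := w * (y.2 - α y ^ 2)
  refine proportion_eq hp hz measurePreserving_splitFour
    (Y := red p ⁻¹' {(0, 2 * PadicInt.toZMod ζ)}) (measurableSet_preimage_red _) ?_
    (σ := fun y ↦ (2 * α y * β y, β y ^ 2)) ?_ isOpen_irreducible_monicQuartic.measurableSet ?_ ?_
  · rw [haarProd_real_preimage_red_singleton]
    positivity
  · refine Continuous.measurable ?_
    fun_prop
  · intro c
    refine (congrModP_sq_iff ζ c).trans ?_
    rw [Set.mem_preimage, red_apply, Set.mem_singleton_iff, Prod.mk.injEq]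
    refine and_congr_right fun ⟨h3, h2⟩ ↦ (red_sub_eq_zero_iff ?_ ?_).symm
    · simp only [α, map_mul]
      exact mul_eq_zero_of_right _ h3
    · have h3' : PadicInt.toZMod (splitFour p c).1.1 = 0 := h3
      have h2' : PadicInt.toZMod (splitFour p c).1.2 = 2 * PadicInt.toZMod ζ := h2
      simp only [β, α, map_mul, map_sub, map_pow, h3', h2']
      linear_combination PadicInt.toZMod ζ * hw'
  · intro c hc
    obtain ⟨⟨h3, h2⟩, h1, h0⟩ := (congrModP_sq_iff ζ c).1 hc
    refine not_irreducible_iff_mem_evenSquares hp hz hw c h3 h2 h1 h0 ?_ ?_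
    · change c 3 = 2 * (w * c 3)
      linear_combination -c 3 * hw
    · change c 2 = (w * c 3) ^ 2 + 2 * (w * (c 2 - (w * c 3) ^ 2))
      linear_combination (-(c 2 - (w * c 3) ^ 2)) * hw

theorem proportion_tracelessQuartic (hp : p ≠ 2) {ζ : ℤ_[p]}
    (hz : ∀ t, t ^ 2 + PadicInt.toZMod ζ ≠ 0) :
    proportion {c : Fin 3 → ℤ_[p] | CongrModP (tracelessQuartic c) ((X ^ 2 + C ζ) ^ 2)}
      {c | Irreducible (tracelessQuartic c)} =
        (2 * (p : ℝ) ^ 2 + 1) / (2 * ((p : ℝ) ^ 2 + 1)) := by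
  obtain ⟨w, hw⟩ := exists_two_mul_eq_one hp
  have hw' : 2 * PadicInt.toZMod w = 1 := by
    rw [← map_ofNat (PadicInt.toZMod (p := p)) 2, ← map_mul, hw, map_one]
  have hcongr (c : Fin 3 → ℤ_[p]) : CongrModP (tracelessQuartic c) ((X ^ 2 + C ζ) ^ 2) ↔
      PadicInt.toZMod (c 2) = 2 * PadicInt.toZMod ζ ∧
        PadicInt.toZMod (c 1) = 0 ∧ PadicInt.toZMod (c 0) = PadicInt.toZMod ζ ^ 2 := by
    rw [tracelessQuartic_eq, congrModP_sq_iff]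
    simp
  have hYopen : IsOpen (PadicInt.toZMod ⁻¹' {2 * PadicInt.toZMod ζ} : Set ℤ_[p]) :=
    (isOpen_discrete _).preimage continuous_toZMod
  -- The same `σ` with `α = 0` and `β = c₂/2`; the factor `2 * 0` keeps the shape `2 * α * β`.
  refine proportion_eq hp hz measurePreserving_splitThree
    (Y := PadicInt.toZMod ⁻¹' {2 * PadicInt.toZMod ζ}) hYopen.measurableSet ?_
    (σ := fun y ↦ (2 * 0 * (w * y), (w * y) ^ 2)) ?_
    isOpen_irreducible_tracelessQuartic.measurableSet ?_ ?_
  · rw [measureReal_def, ENNReal.toReal_ne_zero]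
    refine ⟨(hYopen.measure_pos _ ⟨2 * ζ, ?_⟩).ne', measure_ne_top _ _⟩
    simp [map_ofNat]
  · refine Continuous.measurable ?_
    fun_prop
  · intro c
    refine (hcongr c).trans ?_
    rw [Set.mem_preimage, Set.mem_singleton_iff]
    refine and_congr_right fun h2 ↦ (red_sub_eq_zero_iff (map_zero _) ?_).symm
    have h2' : PadicInt.toZMod (splitThree p c).1 = 2 * PadicInt.toZMod ζ := h2
    rw [map_mul, h2']
    linear_combination PadicInt.toZMod ζ * hw'
  · intro c hc
    obtain ⟨h2, h1, h0⟩ := (hcongr c).1 hc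
    rw [Set.mem_ofPred_eq, tracelessQuartic_eq]
    refine not_irreducible_iff_mem_evenSquares hp hz hw ![c 0, c 1, c 2, 0] (map_zero _) h2 h1 h0
      (mul_zero _).symm ?_
    change c 2 = 0 ^ 2 + 2 * (w * c 2)
    linear_combination -c 2 * hw

end Quartics
end PadicQuartic

theorem lemma4p2 (p : ℕ) [Fact p.Prime] (hp : p ≠ 2) (ζ : ℤ_[p])
    (hζ : Irreducible ((X ^ 2 + C ζ : ℤ_[p][X]).map PadicInt.toZMod)) :
    (MeasurableSet {c : Fin 4 → ℤ_[p] | Irreducible (PadicQuartic.monicQuartic c)} ∧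
      PadicQuartic.proportion
        {c : Fin 4 → ℤ_[p] |
          PadicQuartic.CongrModP (PadicQuartic.monicQuartic c) ((X ^ 2 + C ζ) ^ 2)}
        {c : Fin 4 → ℤ_[p] | Irreducible (PadicQuartic.monicQuartic c)}
        = (2 * (p : ℝ) ^ 2 + 1) / (2 * ((p : ℝ) ^ 2 + 1))) ∧
    (MeasurableSet {c : Fin 3 → ℤ_[p] | Irreducible (PadicQuartic.tracelessQuartic c)} ∧
      PadicQuartic.proportion
        {c : Fin 3 → ℤ_[p] |
          PadicQuartic.CongrModP (PadicQuartic.tracelessQuartic c) ((X ^ 2 + C ζ) ^ 2)}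
        {c : Fin 3 → ℤ_[p] | Irreducible (PadicQuartic.tracelessQuartic c)}
        = (2 * (p : ℝ) ^ 2 + 1) / (2 * ((p : ℝ) ^ 2 + 1))) := by
  have hz := PadicQuartic.sq_add_ne_zero_of_irreducible hζ
  exact ⟨⟨PadicQuartic.isOpen_irreducible_monicQuartic.measurableSet,
      PadicQuartic.proportion_monicQuartic hp hz⟩,
    PadicQuartic.isOpen_irreducible_tracelessQuartic.measurableSet,
    PadicQuartic.proportion_tracelessQuartic hp hz⟩
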